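/- Let $\lambda$ be a limit ordinal and let $\mathcal{E}_\lambda$ be the set of elementary embeddings $j:\langle V_\lambda,\in\rangle\to\langle V_\lambda,\in\rangle$ other than the identity. For $j\in\mathcal{E}_\lambda$ let $\operatorname{crit} j$ be the least ordinal $\alpha<\lambda$ with $\alpha<j(\alpha)$, and let the critical sequence $\langle\kappa_i : i<\omega\rangle$ of $j$ be given by $\kappa_0=\operatorname{crit} j$ and $\kappa_{i+1}=j(\kappa_i)$. For $A\subseteq V_\lambda$ put $j\cdot A=\bigcup_{\alpha<\lambda} j(A\cap V_\alpha)$, and for $j,k:V_\lambda\to V_\lambda$ let the application $jk$ be the function whose graph is $j\cdot k$, where $k$ is identified with its graph. Define the right powers of $j$ by $j^{(0)}=j$ and $j^{(n+1)}=j^{(n)}j^{(n)}$. The inverse limit $k_0\circ k_1\circ k_2\circ\cdots$ of a sequence $\langle k_n : n<\omega\rangle$ of embeddings in $\mathcal{E}_\lambda$ is the function that sends each $a\in V_{\bar\lambda}$, where $\bar\lambda=\liminf_{n<\omega}\operatorname{crit} k_n$, to $(k_0\circ k_1\circ\cdots\circ k_n)(a)$ for any $n$ large enough that $k_m(a)=a$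 for all $m>n$. Suppose that $j\in\mathcal{E}_\lambda$ has critical sequence $\langle\kappa_i : i<\omega\rangle$, and let $k=j\circ j^{(1)}\circ j^{(2)}\circ\cdots$ be the inverse limit of the right powers of $j$. Then all these objects are well defined: each $j^{(n)}$ moves some ordinal upwards and so has a critical point, every $\kappa_n$ is below $\lambda$, each set $j^{(n)}\cdot j^{(n)}$ is the graph of a function $V_\lambda\to V_\lambda$, and every element of the domain of $k$ is fixed by $j^{(m)}$ for all sufficiently large $m$. Moreover, every ordinal below $\lambda$ in the range of $k$ is either less than $\kappa_0$ or contained in an odd interval of the critical sequence of $j$: $$\operatorname{rng} k\cap\lambda\subseteq[0,\kappa_0)\cup\bigcup_{n<\omega}[\kappa_{2n+1},\kappa_{2n+2}).$$ -/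

import Mathlib

open scoped ZFSet

universe u

namespace RankToRank

/-- The relation symbols of the language of set theory: one binary symbol. -/
inductive SetRel : ℕ → Type
  | mem : SetRel 2

/-- The first-order language `{∈}` of set theory. -/
def setLang : FirstOrder.Language := ⟨fun _ => Empty, SetRel⟩

/-- The rank initial segment `V_lam` of the universe of sets, as a type. -/
abbrev Level (lam : Ordinal.{u}) : Type (u + 1) := {x : ZFSet.{u} // x ∈ V_ lam}

/-- `V_lam` as the structure `⟨V_lam, ∈⟩`. -/
instance levelStructure (lam : Ordinal.{u}) : setLang.Structure (Level lam) where
  funMap f := f.elim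
  RelMap | .mem => fun x => (x 0).1 ∈ (x 1).1

/-- The set `E_lam` of rank-to-rank embeddings: elementary embeddings of `⟨V_lam, ∈⟩` into
itself, in the full first-order language, that are not the identity. -/
def rankEmbeddings (lam : Ordinal.{u}) : Set (Level lam → Level lam) :=
  {j | (∃ e : setLang.ElementaryEmbedding (Level lam) (Level lam), ∀ x, e x = j x) ∧ j ≠ id}

theorem toZFSet_mem_level {lam α : Ordinal.{u}} (h : α < lam) : α.toZFSet ∈ V_ lam := by
  rw [ZFSet.mem_vonNeumann, Ordinal.rank_toZFSet]; exact h

/-- An ordinal `α < lam` as an element of `V_lam`. -/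
noncomputable def ordElem {lam : Ordinal.{u}} (α : Set.Iio lam) : Level lam :=
  ⟨α.1.toZFSet, toZFSet_mem_level α.2⟩

/-- The value `j(α)` at an ordinal `α < lam`, as an ordinal (an elementary `j` sends ordinals to
ordinals, and the rank of the von Neumann ordinal `j(α)` is that ordinal). -/
noncomputable def ordValue {lam : Ordinal.{u}} (j : Level lam → Level lam) (α : Set.Iio lam) :
    Ordinal.{u} :=
  (j (ordElem α)).1.rank

/-- The ordinals `α < lam` with `α < j(α)`. -/
def movedOrdinals {lam : Ordinal.{u}} (j : Level lam → Level lam) : Set Ordinal.{u} :=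
  {α | ∃ h : α < lam, α < ordValue j ⟨α, h⟩}

/-- The critical point of `j`: the least ordinal `α` with `α < j(α)`. -/
noncomputable def crit {lam : Ordinal.{u}} (j : Level lam → Level lam) : Ordinal.{u} :=
  sInf (movedOrdinals j)

open Classical in
/-- The critical sequence of `j`: `κ_0` is the critical point and `κ_{n+1} = j(κ_n)`. -/
noncomputable def critSeq {lam : Ordinal.{u}} (j : Level lam → Level lam) : ℕ → Ordinal.{u}
  | 0 => crit j
  | n + 1 => if h : critSeq j n < lam then ordValue j ⟨critSeq j n, h⟩ else 0

theorem inter_mem_level {lam : Ordinal.{u}} (A : ZFSet.{u}) (α : Set.Iio lam) :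
    A ∩ V_ α.1 ∈ V_ lam := by
  rw [ZFSet.mem_vonNeumann]
  refine lt_of_le_of_lt ?_ α.2
  rw [← ZFSet.subset_vonNeumann]
  intro x hx
  exact (ZFSet.mem_inter.1 hx).2

/-- The extension of `j` to subsets of `V_lam`:
`j · A` is the union of the sets `j (A ∩ V_α)` over all `α < lam`. -/
noncomputable def extend {lam : Ordinal.{u}} (j : Level lam → Level lam) (A : ZFSet.{u}) :
    ZFSet.{u} :=
  ZFSet.iUnion fun α : Set.Iio lam => (j ⟨A ∩ V_ α.1, inter_mem_level A α⟩).1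

/-- The graph of `k`, a subset of `V_lam`: the set of all ordered pairs `⟨x, k x⟩`. -/
noncomputable def graph {lam : Ordinal.{u}} (k : Level lam → Level lam) : ZFSet.{u} :=
  ZFSet.range fun x : Level lam => ZFSet.pair x.1 (k x).1

open Classical in
/-- The application `j k` of `j` to `k`: the function whose graph is `j · (graph of k)`. -/
noncomputable def app {lam : Ordinal.{u}} (j k : Level lam → Level lam) :
    Level lam → Level lam := fun x =>
  if h : ∃ y : Level lam, ZFSet.pair x.1 y.1 ∈ extend j (graph k) then h.choose else x

/-- The right powers of `j`: `j^(0) = j` and `j^(n+1) = j^(n) j^(n)`. -/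
noncomputable def rightPower {lam : Ordinal.{u}} (j : Level lam → Level lam) :
    ℕ → Level lam → Level lam
  | 0 => j
  | n + 1 => app (rightPower j n) (rightPower j n)

/-- The finite composite `k_0 ∘ k_1 ∘ ⋯ ∘ k_n`. -/
def composite {lam : Ordinal.{u}} (k : ℕ → Level lam → Level lam) : ℕ → Level lam → Level lam
  | 0 => k 0
  | n + 1 => composite k n ∘ k (n + 1)

/-- The height of the domain of the inverse limit: the limit inferior of the critical points. -/
noncomputable def limitHeight {lam : Ordinal.{u}} (k : ℕ → Level lam → Level lam) :
    Ordinal.{u} :=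
  Filter.liminf (fun n => crit (k n)) Filter.atTop

/-- The domain of the inverse limit: the elements of `V_lam` that lie in `V_μ`, where `μ ≤ lam` is
the limit inferior of the critical points. -/
abbrev LimitDomain {lam : Ordinal.{u}} (k : ℕ → Level lam → Level lam) : Type (u + 1) :=
  {a : Level lam // a.1 ∈ V_ (limitHeight k)}

/-- The inverse limit `k_0 ∘ k_1 ∘ k_2 ∘ ⋯`: at `a` it is `(k_0 ∘ ⋯ ∘ k_n) a`, where `n` is large
enough that `k_m a = a` for all `m > n` (the least such `n` is taken). -/
noncomputable def inverseLimit {lam : Ordinal.{u}} (k : ℕ → Level lam → Level lam)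
    (a : LimitDomain k) : Level lam :=
  composite k (sInf {n : ℕ | ∀ m > n, k m a.1 = a.1}) a.1

end RankToRank

/-! Everything is measured by rank. The right power `j^(n)` is elementary with critical point `κ_n`
and sends `κ_m` to `κ_(m+1)` for every `m ≥ n` (`crit_rightPower`, `ordValue_rightPower_critSeq`).
So a set of rank in `[κ_n, κ_(n+1))` is fixed by all `j^(m)` with `m > n`, while each of the `n + 1`
maps `j^(n), ..., j^(0)` pushes its rank up by exactly one interval. The limit therefore lands in
`[κ_(2n+1), κ_(2n+2))`; sets of rank below `κ_0` are not moved at all.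

The shift of critical sequences rests on `jj` being elementary and on `(jj)(j x) = j(j x)`. Each
fact about `jj` is a first-order statement about a truncation of the graph of `j`, which is an
element of `V_lam`, and is carried over by `j`. Comparing ranks inside `⟨V_lam, ∈⟩` in turn needs
`j(V_(rank x)) = V_(rank j(x))`, proved in `IsElementary.map_stage`. -/

namespace RankToRank

/-! ### Closure properties of first-order definability in `⟨V_lam, ∈⟩`. -/

section Expressible

variable {lam : Ordinal.{u}} {α β : Type}

/-- A condition on assignments of elements of `V_lam` to variables is expressible if some
first-order formula without parameters defines it. -/
def Expressible (P : (α → Level lam) → Prop) : Prop :=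
  ∃ φ : setLang.Formula α, ∀ v, φ.Realize v ↔ P v

/-- The projections of assignments to a single variable. -/
def IsVar (f : (α → Level lam) → Level lam) : Prop :=
  ∃ i, ∀ v, f v = v i

theorem IsVar.proj (i : α) : IsVar fun v : α → Level lam => v i :=
  ⟨i, fun _ => rfl⟩

theorem IsVar.comp {f : (α → Level lam) → Level lam} (hf : IsVar f) (g : α → β) :
    IsVar fun w : β → Level lam => f (w ∘ g) := by
  obtain ⟨i, hi⟩ := hf
  exact ⟨g i, fun w => hi _⟩

theorem Expressible.congr {P Q : (α → Level lam) → Prop} (h : Expressible P)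
    (hPQ : ∀ v, P v ↔ Q v) : Expressible Q := by
  obtain ⟨φ, hφ⟩ := h
  exact ⟨φ, fun v => (hφ v).trans (hPQ v)⟩

theorem Expressible.comp {P : (α → Level lam) → Prop} (h : Expressible P) (g : α → β) :
    Expressible fun w : β → Level lam => P (w ∘ g) := by
  obtain ⟨φ, hφ⟩ := h
  exact ⟨φ.relabel g, fun v => by rw [FirstOrder.Language.Formula.realize_relabel, hφ]⟩

theorem expressible_realize (φ : setLang.Formula α) :
    Expressible fun v : α → Level lam => φ.Realize v :=
  ⟨φ, fun _ => Iff.rfl⟩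

theorem expressible_mem {f g : (α → Level lam) → Level lam} (hf : IsVar f) (hg : IsVar g) :
    Expressible fun v => (f v).1 ∈ (g v).1 := by
  obtain ⟨i, hi⟩ := hf
  obtain ⟨k, hk⟩ := hg
  refine ⟨FirstOrder.Language.Relations.formula₂ (L := setLang) SetRel.mem
    (FirstOrder.Language.Term.var i) (FirstOrder.Language.Term.var k), fun v => ?_⟩
  refine FirstOrder.Language.Formula.realize_rel₂.trans ?_
  change (v i).1 ∈ (v k).1 ↔ (f v).1 ∈ (g v).1
  rw [hi, hk]

theorem expressible_eq {f g : (α → Level lam) → Level lam} (hf : IsVar f) (hg : IsVar g) :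
    Expressible fun v => f v = g v := by
  obtain ⟨i, hi⟩ := hf
  obtain ⟨k, hk⟩ := hg
  refine ⟨FirstOrder.Language.Term.equal (FirstOrder.Language.Term.var i)
    (FirstOrder.Language.Term.var k), fun v => ?_⟩
  rw [FirstOrder.Language.Formula.realize_equal]
  change v i = v k ↔ f v = g v
  rw [hi, hk]

theorem Expressible.not {P : (α → Level lam) → Prop} (hP : Expressible P) :
    Expressible fun v => ¬ P v := by
  obtain ⟨φ, hφ⟩ := hP
  exact ⟨φ.not, fun v => by rw [FirstOrder.Language.Formula.realize_not, hφ]⟩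

theorem Expressible.imp {P Q : (α → Level lam) → Prop} (hP : Expressible P)
    (hQ : Expressible Q) : Expressible fun v => P v → Q v := by
  obtain ⟨φ, hφ⟩ := hP
  obtain ⟨ψ, hψ⟩ := hQ
  exact ⟨φ.imp ψ, fun v => by rw [FirstOrder.Language.Formula.realize_imp, hφ, hψ]⟩

theorem Expressible.and {P Q : (α → Level lam) → Prop} (hP : Expressible P)
    (hQ : Expressible Q) : Expressible fun v => P v ∧ Q v :=
  (hP.imp hQ.not).not.congr fun v => by tauto

theorem Expressible.or {P Q : (α → Level lam) → Prop} (hP : Expressible P)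
    (hQ : Expressible Q) : Expressible fun v => P v ∨ Q v :=
  (hP.not.imp hQ).congr fun v => by tauto

theorem Expressible.iff {P Q : (α → Level lam) → Prop} (hP : Expressible P)
    (hQ : Expressible Q) : Expressible fun v => P v ↔ Q v :=
  ((hP.imp hQ).and (hQ.imp hP)).congr fun v => by tauto

theorem Expressible.finite_forall [Finite β] {P : β → (α → Level lam) → Prop}
    (hP : ∀ b, Expressible (P b)) : Expressible fun v => ∀ b, P b v := by
  choose φ hφ using hP
  exact ⟨FirstOrder.Language.Formula.iInf φ, fun v => by
    rw [FirstOrder.Language.Formula.realize_iInf]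
    exact forall_congr' fun b => hφ b v⟩

theorem Expressible.forall_tuple [Finite β] {P : (α → Level lam) → (β → Level lam) → Prop}
    (hP : Expressible fun w : α ⊕ β → Level lam => P (w ∘ Sum.inl) (w ∘ Sum.inr)) :
    Expressible fun v => ∀ x, P v x := by
  obtain ⟨φ, hφ⟩ := hP
  refine ⟨φ.iAlls β, fun v => ?_⟩
  rw [FirstOrder.Language.Formula.realize_iAlls]
  exact forall_congr' fun x => hφ _

theorem Expressible.all {P : (α → Level lam) → Level lam → Prop}
    (hP : Expressible fun w : α ⊕ Unit → Level lam => P (w ∘ Sum.inl) (w (Sum.inr ()))) :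
    Expressible fun v => ∀ x, P v x :=
  (Expressible.forall_tuple (β := Unit) (P := fun v x => P v (x ())) hP).congr fun _ =>
    ⟨fun h x => h fun _ => x, fun h x => h (x ())⟩

theorem Expressible.ex {P : (α → Level lam) → Level lam → Prop}
    (hP : Expressible fun w : α ⊕ Unit → Level lam => P (w ∘ Sum.inl) (w (Sum.inr ()))) :
    Expressible fun v => ∃ x, P v x :=
  (Expressible.all (P := fun v x => ¬ P v x) hP.not).not.congr fun v => by
    push Not; rfl

theorem mem_level_of_mem {x y : ZFSet.{u}} (hxy : x ∈ y) (hy : y ∈ V_ lam) : x ∈ V_ lam :=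
  (ZFSet.isTransitive_vonNeumann lam) |>.mem_trans hxy hy

theorem level_ext {x y : Level lam} (h : ∀ z : Level lam, z.1 ∈ x.1 ↔ z.1 ∈ y.1) : x = y := by
  apply Subtype.ext
  ext z
  exact ⟨fun hz => (h ⟨z, mem_level_of_mem hz x.2⟩).1 hz,
    fun hz => (h ⟨z, mem_level_of_mem hz y.2⟩).2 hz⟩

theorem expressible_subset {f g : (α → Level lam) → Level lam} (hf : IsVar f) (hg : IsVar g) :
    Expressible fun v => (f v).1 ⊆ (g v).1 := by
  refine Expressible.congr (P := fun v => ∀ z : Level lam, z.1 ∈ (f v).1 → z.1 ∈ (g v).1)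
    (.all <| .imp (expressible_mem (.proj _) (hf.comp _))
      (expressible_mem (.proj _) (hg.comp _))) fun v => ?_
  exact ⟨fun h z hz => h ⟨z, mem_level_of_mem hz (f v).2⟩ hz, fun h z hz => h hz⟩

theorem expressible_unorderedPair {f g h : (α → Level lam) → Level lam} (hf : IsVar f)
    (hg : IsVar g) (hh : IsVar h) :
    Expressible fun v => (h v).1 = {(f v).1, (g v).1} := by
  refine Expressible.congr
    (P := fun v => ∀ z : Level lam, z.1 ∈ (h v).1 ↔ z = f v ∨ z = g v)
    (.all <| .iff (expressible_mem (.proj _) (hh.comp _))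
      (.or (expressible_eq (.proj _) (hf.comp _)) (expressible_eq (.proj _) (hg.comp _))))
    fun v => ?_
  constructor
  · intro H
    ext z
    rw [ZFSet.mem_pair]
    constructor
    · intro hz
      simpa [Subtype.ext_iff] using (H ⟨z, mem_level_of_mem hz (h v).2⟩).1 hz
    · rintro (rfl | rfl)
      · exact (H (f v)).2 (Or.inl rfl)
      · exact (H (g v)).2 (Or.inr rfl)
  · intro H z
    rw [H, ZFSet.mem_pair, Subtype.ext_iff, Subtype.ext_iff]

theorem expressible_eq_pair {f g h : (α → Level lam) → Level lam} (hf : IsVar f)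
    (hg : IsVar g) (hh : IsVar h) :
    Expressible fun v => (h v).1 = ZFSet.pair (f v).1 (g v).1 := by
  refine Expressible.congr
    (P := fun v => ∃ s t : Level lam, s.1 = {(f v).1, (f v).1} ∧ t.1 = {(f v).1, (g v).1} ∧
      (h v).1 = {s.1, t.1})
    (.ex <| .ex <| .and
      (expressible_unorderedPair ((hf.comp _).comp _) ((hf.comp _).comp _)
        ((IsVar.proj _).comp _))
      (.and (expressible_unorderedPair ((hf.comp _).comp _) ((hg.comp _).comp _) (.proj _))
        (expressible_unorderedPair ((IsVar.proj _).comp _) (.proj _) ((hh.comp _).comp _))))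
    fun v => ?_
  constructor
  · rintro ⟨s, t, hs, ht, H⟩
    rw [H, hs, ht, ZFSet.pair_eq_singleton, ZFSet.pair]
  · intro H
    -- Both components of a Kuratowski pair are elements of it, hence in `V_lam` by transitivity.
    refine ⟨⟨{(f v).1, (f v).1}, mem_level_of_mem ?_ (h v).2⟩,
      ⟨{(f v).1, (g v).1}, mem_level_of_mem ?_ (h v).2⟩, rfl, rfl, ?_⟩
    · rw [H, ZFSet.pair_eq_singleton, ZFSet.pair]; simp
    · rw [H, ZFSet.pair]; simp
    · exact H.trans (by simp only [ZFSet.pair_eq_singleton, ZFSet.pair])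

theorem expressible_pair_mem {f g h : (α → Level lam) → Level lam} (hf : IsVar f)
    (hg : IsVar g) (hh : IsVar h) :
    Expressible fun v => ZFSet.pair (f v).1 (g v).1 ∈ (h v).1 := by
  refine Expressible.congr
    (P := fun v => ∃ p : Level lam, p.1 = ZFSet.pair (f v).1 (g v).1 ∧ p.1 ∈ (h v).1)
    (.ex <| .and (expressible_eq_pair (hf.comp _) (hg.comp _) (.proj _))
      (expressible_mem (.proj _) (hh.comp _))) fun v => ?_
  exact ⟨fun ⟨p, hp, h⟩ => hp ▸ h, fun h => ⟨⟨_, mem_level_of_mem h (Subtype.property _)⟩, rfl, h⟩⟩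

end Expressible

/-! ### Elementary maps and transfer of definable conditions. -/

section Elementary

variable {lam : Ordinal.{u}}

/-- Elementarity of a map of `⟨V_lam, ∈⟩` into itself. -/
def IsElementary (j : Level lam → Level lam) : Prop :=
  ∃ e : setLang.ElementaryEmbedding (Level lam) (Level lam), ∀ x, e x = j x

variable {j : Level lam → Level lam}

theorem IsElementary.iff (hj : IsElementary j) {α : Type} {P : (α → Level lam) → Prop}
    (hP : Expressible P) (v : α → Level lam) : P (j ∘ v) ↔ P v := by
  obtain ⟨e, he⟩ := hj
  obtain ⟨φ, hφ⟩ := hP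
  have : j = e := funext fun x => (he x).symm
  rw [← hφ, ← hφ, this, e.map_formula]

theorem IsElementary.mem_iff (hj : IsElementary j) (x y : Level lam) :
    (j x).1 ∈ (j y).1 ↔ x.1 ∈ y.1 :=
  hj.iff (P := fun v : Fin 2 → Level lam => (v 0).1 ∈ (v 1).1)
    (expressible_mem (.proj _) (.proj _)) ![x, y]

theorem IsElementary.subset_iff (hj : IsElementary j) (x y : Level lam) :
    (j x).1 ⊆ (j y).1 ↔ x.1 ⊆ y.1 :=
  hj.iff (P := fun v : Fin 2 → Level lam => (v 0).1 ⊆ (v 1).1)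
    (expressible_subset (.proj _) (.proj _)) ![x, y]

theorem IsElementary.pair_mem_iff (hj : IsElementary j) (x y z : Level lam) :
    ZFSet.pair (j x).1 (j y).1 ∈ (j z).1 ↔ ZFSet.pair x.1 y.1 ∈ z.1 :=
  hj.iff (P := fun v : Fin 3 → Level lam => ZFSet.pair (v 0).1 (v 1).1 ∈ (v 2).1)
    (expressible_pair_mem (.proj _) (.proj _) (.proj _)) ![x, y, z]

theorem IsElementary.of_formula
    (h : ∀ (n : ℕ) (φ : setLang.Formula (Fin n)) (x : Fin n → Level lam),
      φ.Realize (j ∘ x) ↔ φ.Realize x) : IsElementary j :=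
  ⟨⟨j, fun n φ x => h n φ x⟩, fun _ => rfl⟩

end Elementary

/-! ### Elementary maps respect the cumulative hierarchy and rank. -/

section Stages

variable {lam : Ordinal.{u}}

theorem rank_lt_lam (x : Level lam) : x.1.rank < lam :=
  ZFSet.mem_vonNeumann.1 x.2

theorem rank_pair_lt {x y : ZFSet.{u}} {γ : Ordinal.{u}} (hx : x.rank < γ) (hy : y.rank < γ) :
    (ZFSet.pair x y).rank < Order.succ (Order.succ γ) := by
  have hx' := Order.succ_le_of_lt hx
  have hy' := Order.succ_le_of_lt hy
  simp only [ZFSet.pair, ZFSet.rank_pair, ZFSet.rank_singleton, Order.lt_succ_iff]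
  exact max_le (Order.succ_le_succ hx') (Order.succ_le_succ (max_le hx' hy'))

theorem rank_pair_mono {x y x' y' : ZFSet.{u}} (hx : x'.rank ≤ x.rank) (hy : y'.rank ≤ y.rank) :
    (ZFSet.pair x' y').rank ≤ (ZFSet.pair x y).rank := by
  simp only [ZFSet.pair, ZFSet.rank_pair, ZFSet.rank_singleton]
  gcongr

/-- The stage `V_α` of the cumulative hierarchy, where `α` is the rank of `x`. -/
noncomputable def stage (x : Level lam) : Level lam :=
  ⟨V_ x.1.rank, ZFSet.vonNeumann_mem_of_lt (rank_lt_lam x)⟩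

/-- The part inside `V_δ` of the graph of `b ↦ V_(rank b)`. -/
noncomputable def stageGraph (δ : Set.Iio lam) : Level lam :=
  ⟨ZFSet.sep (fun p => ∃ b, p = ZFSet.pair b (V_ b.rank)) (V_ δ.1), by
    rw [ZFSet.mem_vonNeumann]
    refine lt_of_le_of_lt (ZFSet.subset_vonNeumann.1 fun x hx => ?_) δ.2
    exact (ZFSet.mem_sep.1 hx).1⟩

theorem pair_mem_stageGraph {δ : Set.Iio lam} {b w : ZFSet.{u}} :
    ZFSet.pair b w ∈ (stageGraph δ).1 ↔ (ZFSet.pair b w).rank < δ.1 ∧ w = V_ b.rank := by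
  simp only [stageGraph, ZFSet.mem_sep, ZFSet.mem_vonNeumann, ZFSet.pair_inj]
  constructor
  · rintro ⟨h, b, rfl, rfl⟩
    exact ⟨h, rfl⟩
  · rintro ⟨h, rfl⟩
    exact ⟨h, b, rfl, rfl⟩

/-- The recursion that characterizes `b ↦ V_(rank b)` on a transitive domain. -/
def IsStageGraph (g : Level lam) : Prop :=
  ∀ b w : Level lam, ZFSet.pair b.1 w.1 ∈ g.1 →
    (∀ c : Level lam, c.1 ∈ b.1 → ∃ w' : Level lam, ZFSet.pair c.1 w'.1 ∈ g.1) ∧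
    ∀ z : Level lam, z.1 ∈ w.1 ↔
      ∃ c : Level lam, c.1 ∈ b.1 ∧ ∃ w' : Level lam, ZFSet.pair c.1 w'.1 ∈ g.1 ∧ z.1 ⊆ w'.1

theorem expressible_isStageGraph :
    Expressible fun v : Fin 1 → Level lam => IsStageGraph (v 0) := by
  refine .all <| .all <| .imp (expressible_pair_mem (.comp (.proj _) _) (.proj _)
    (.comp (.comp (.proj _) _) _)) (.and (.all <| .imp ?_ <| .ex ?_)
      (.all <| .iff ?_ <| .ex <| .and ?_ <| .ex <| .and ?_ ?_))
  · exact expressible_mem (.proj _) (.proj _)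
  · exact expressible_pair_mem (.proj _) (.proj _) (.proj _)
  · exact expressible_mem (.proj _) (.proj _)
  · exact expressible_mem (.proj _) (.proj _)
  · exact expressible_pair_mem (.proj _) (.proj _) (.proj _)
  · exact expressible_subset (.proj _) (.proj _)

/-- Cutting at `V_δ` is harmless: passing from `b` to a member `c` does not raise the rank of the
pair, so the domain stays closed under members. -/
theorem isStageGraph_stageGraph (δ : Set.Iio lam) : IsStageGraph (stageGraph δ) := by
  intro b w h
  obtain ⟨hδ, hw⟩ := pair_mem_stageGraph.1 h
  have key : ∀ c : Level lam, c.1 ∈ b.1 →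
      ZFSet.pair c.1 (stage c).1 ∈ (stageGraph δ).1 := fun c hc => by
    have hr := (ZFSet.rank_lt_of_mem hc).le
    refine pair_mem_stageGraph.2 ⟨lt_of_le_of_lt (rank_pair_mono hr ?_) hδ, rfl⟩
    rw [hw, stage, ZFSet.rank_vonNeumann, ZFSet.rank_vonNeumann]
    exact hr
  refine ⟨fun c hc => ⟨_, key c hc⟩, fun z => ?_⟩
  rw [hw, ZFSet.mem_vonNeumann, ZFSet.lt_rank_iff]
  constructor
  · rintro ⟨c, hc, hz⟩
    exact ⟨⟨c, mem_level_of_mem hc b.2⟩, hc, _, key ⟨c, mem_level_of_mem hc b.2⟩ hc,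
      ZFSet.subset_vonNeumann.2 hz⟩
  · rintro ⟨c, hc, w', hw', hz⟩
    rw [(pair_mem_stageGraph.1 hw').2] at hz
    exact ⟨c.1, hc, ZFSet.subset_vonNeumann.1 hz⟩

/-- The recursion has only one solution, by ∈-induction on `b`; hence the image of a stage graph
under an elementary map again computes true stages. -/
theorem IsStageGraph.eq_stage {g : Level lam} (hg : IsStageGraph g) {b w : Level lam}
    (h : ZFSet.pair b.1 w.1 ∈ g.1) : w = stage b := by
  obtain ⟨b, hb⟩ := b
  induction b using ZFSet.inductionOn generalizing w with
  | _ b ih =>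
    obtain ⟨h₁, h₂⟩ := hg _ _ h
    refine level_ext fun z => ?_
    rw [h₂, stage, ZFSet.mem_vonNeumann, ZFSet.lt_rank_iff]
    constructor
    · rintro ⟨c, hc, w', hw', hz⟩
      rw [ih c.1 hc c.2 hw'] at hz
      exact ⟨c.1, hc, ZFSet.subset_vonNeumann.1 hz⟩
    · rintro ⟨c, hc, hz⟩
      obtain ⟨w', hw'⟩ := h₁ ⟨c, mem_level_of_mem hc hb⟩ hc
      refine ⟨⟨c, mem_level_of_mem hc hb⟩, hc, w', hw', ?_⟩
      rw [ih c hc _ hw']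
      exact ZFSet.subset_vonNeumann.2 hz

variable {j : Level lam → Level lam}

theorem IsElementary.map_stage (hlam : Order.IsSuccLimit lam) (hj : IsElementary j)
    (x : Level lam) : j (stage x) = stage (j x) := by
  -- Both coordinates have rank below the successor of the rank of `x`, and a Kuratowski pair costs
  -- two more.
  let δ : Set.Iio lam := ⟨Order.succ (Order.succ (Order.succ x.1.rank)),
    hlam.succ_lt (hlam.succ_lt (hlam.succ_lt (rank_lt_lam x)))⟩
  have hg : IsStageGraph (j (stageGraph δ)) :=
    (hj.iff expressible_isStageGraph ![stageGraph δ]).2 (isStageGraph_stageGraph δ)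
  refine hg.eq_stage ((hj.pair_mem_iff _ _ _).2 (pair_mem_stageGraph.2 ⟨?_, rfl⟩))
  refine rank_pair_lt (Order.lt_succ _) ?_
  rw [stage, ZFSet.rank_vonNeumann]
  exact Order.lt_succ _

theorem IsElementary.rank_le_iff (hlam : Order.IsSuccLimit lam) (hj : IsElementary j)
    (x y : Level lam) : (j x).1.rank ≤ (j y).1.rank ↔ x.1.rank ≤ y.1.rank := by
  have := hj.subset_iff (stage x) (stage y)
  rwa [hj.map_stage hlam, hj.map_stage hlam, stage, stage, stage, stage,
    ZFSet.vonNeumann_subset_vonNeumann_iff, ZFSet.vonNeumann_subset_vonNeumann_iff] at this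

theorem IsElementary.rank_lt_iff (hlam : Order.IsSuccLimit lam) (hj : IsElementary j)
    (x y : Level lam) : (j x).1.rank < (j y).1.rank ↔ x.1.rank < y.1.rank := by
  rw [← not_le, ← not_le, hj.rank_le_iff hlam]

theorem IsElementary.rank_congr (hlam : Order.IsSuccLimit lam) (hj : IsElementary j)
    {x y : Level lam} (h : x.1.rank = y.1.rank) : (j x).1.rank = (j y).1.rank :=
  le_antisymm ((hj.rank_le_iff hlam _ _).2 h.le) ((hj.rank_le_iff hlam _ _).2 h.ge)

theorem IsElementary.rank_le_rank_map (hj : IsElementary j) (x : Level lam) :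
    x.1.rank ≤ (j x).1.rank := by
  obtain ⟨x, hx⟩ := x
  induction x using ZFSet.inductionOn with
  | _ x ih =>
    refine ZFSet.rank_le_iff.2 fun y hy => ?_
    exact (ih y hy (mem_level_of_mem hy hx)).trans_lt
      (ZFSet.rank_lt_of_mem ((hj.mem_iff ⟨y, _⟩ ⟨x, hx⟩).2 hy))

theorem rank_ordElem (α : Set.Iio lam) : (ordElem α).1.rank = α.1 :=
  Ordinal.rank_toZFSet _

theorem IsElementary.rank_map (hlam : Order.IsSuccLimit lam) (hj : IsElementary j)
    (x : Level lam) : (j x).1.rank = ordValue j ⟨x.1.rank, rank_lt_lam x⟩ :=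
  hj.rank_congr hlam (rank_ordElem ⟨_, rank_lt_lam x⟩).symm

/-- An elementary map that fixes the ordinals below `γ` fixes all sets of rank below `γ`. -/
theorem IsElementary.map_eq_of_forall_ordValue (hlam : Order.IsSuccLimit lam)
    (hj : IsElementary j) {γ : Ordinal.{u}}
    (h : ∀ α : Set.Iio lam, α.1 < γ → ordValue j α = α.1) (x : Level lam)
    (hx : x.1.rank < γ) : j x = x := by
  induction hr : x.1.rank using WellFoundedLT.induction generalizing x with
  | _ o ih =>
    subst hr
    refine level_ext fun y => ⟨fun hy => ?_, fun hy => ?_⟩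
    -- A member of `j x` has rank below that of `j x`, which equals that of `x`, so the induction
    -- hypothesis already fixes it.
    · have hlt := ZFSet.rank_lt_of_mem hy
      rw [hj.rank_map hlam, h _ hx] at hlt
      rw [← ih _ hlt y (hlt.trans hx) rfl] at hy
      exact (hj.mem_iff y x).1 hy
    · have hlt := ZFSet.rank_lt_of_mem hy
      rw [← ih _ hlt y (hlt.trans hx) rfl]
      exact (hj.mem_iff y x).2 hy

end Stages

/-! ### The application of one embedding to another. -/

section Application

variable {lam : Ordinal.{u}}

/-- The part of the graph of `k` inside `V_δ`. -/
noncomputable def truncGraph (k : Level lam → Level lam) (δ : Set.Iio lam) : Level lam :=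
  ⟨graph k ∩ V_ δ.1, inter_mem_level (graph k) δ⟩

theorem pair_mem_graph {k : Level lam → Level lam} {x y : Level lam} :
    ZFSet.pair x.1 y.1 ∈ graph k ↔ k x = y := by
  simp only [graph, ZFSet.mem_range, ZFSet.pair_inj]
  constructor
  · rintro ⟨z, hz, h⟩
    rw [← Subtype.ext hz]
    exact Subtype.ext h
  · rintro rfl
    exact ⟨x, rfl, rfl⟩

theorem pair_mem_truncGraph {k : Level lam → Level lam} {δ : Set.Iio lam} {x y : Level lam} :
    ZFSet.pair x.1 y.1 ∈ (truncGraph k δ).1 ↔ k x = y ∧ (ZFSet.pair x.1 y.1).rank < δ.1 := by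
  rw [truncGraph, ZFSet.mem_inter, pair_mem_graph, ZFSet.mem_vonNeumann]

theorem truncGraph_mono (k : Level lam → Level lam) {δ ε : Set.Iio lam} (h : δ ≤ ε) :
    (truncGraph k δ).1 ⊆ (truncGraph k ε).1 := fun _ hp => by
  rw [truncGraph, ZFSet.mem_inter] at hp ⊢
  exact ⟨hp.1, ZFSet.vonNeumann_subset_of_le h hp.2⟩

variable {j k : Level lam → Level lam}

theorem mem_extend_graph {p : ZFSet.{u}} :
    p ∈ extend j (graph k) ↔ ∃ δ : Set.Iio lam, p ∈ (j (truncGraph k δ)).1 :=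
  ZFSet.mem_iUnion

theorem exists_iio_rank_pair_lt (hlam : Order.IsSuccLimit lam) (x y : Level lam) :
    ∃ δ : Set.Iio lam, ∀ x' y' : Level lam, x'.1.rank ≤ x.1.rank → y'.1.rank ≤ y.1.rank →
      (ZFSet.pair x'.1 y'.1).rank < δ.1 := by
  have hm : max x.1.rank y.1.rank < lam := max_lt (rank_lt_lam x) (rank_lt_lam y)
  refine ⟨⟨_, hlam.succ_lt (hlam.succ_lt (hlam.succ_lt hm))⟩, fun x' y' hx hy => ?_⟩
  exact rank_pair_lt (Order.lt_succ_of_le (hx.trans (le_max_left _ _)))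
    (Order.lt_succ_of_le (hy.trans (le_max_right _ _)))

/-- The images of truncations form an increasing chain, so finitely many pairs lie in one of them.
-/
theorem exists_pair_mem_map_truncGraph (hj : IsElementary j) {n : ℕ} {a b : Fin n → Level lam}
    (hlam : Order.IsSuccLimit lam)
    (h : ∀ i, ZFSet.pair (a i).1 (b i).1 ∈ extend j (graph k)) :
    ∃ δ : Set.Iio lam, ∀ i, ZFSet.pair (a i).1 (b i).1 ∈ (j (truncGraph k δ)).1 := by
  choose δ hδ using fun i => mem_extend_graph.1 (h i)
  have : Nonempty (Set.Iio lam) := ⟨⟨0, hlam.bot_lt⟩⟩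
  obtain ⟨ε, hε⟩ := Finite.exists_le δ
  exact ⟨ε, fun i => (hj.subset_iff _ _).2 (truncGraph_mono k (hε i)) (hδ i)⟩

/-- The pairs in `c` relate tuples with the same truth value of `φ`. -/
theorem expressible_realize_iff_of_pairs {n : ℕ} (φ : setLang.Formula (Fin n)) :
    Expressible fun v : Fin 1 → Level lam => ∀ a b : Fin n → Level lam,
      (∀ i, ZFSet.pair (a i).1 (b i).1 ∈ (v 0).1) → (φ.Realize b ↔ φ.Realize a) :=
  .forall_tuple <| .forall_tuple <| .imp
    (.finite_forall fun _ => expressible_pair_mem (.proj _) (.proj _) (.proj _))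
    (.iff (.comp (expressible_realize φ) Sum.inr)
      (.comp (.comp (expressible_realize φ) Sum.inr) Sum.inl))

/-- Truncations of the graph of `k` preserve `φ` because `k` is elementary; `j` transfers this to
their images. It yields both functionality and elementarity of `j k`. -/
theorem realize_iff_of_pairs_mem_extend (hlam : Order.IsSuccLimit lam) (hj : IsElementary j)
    (hk : IsElementary k) {n : ℕ} (φ : setLang.Formula (Fin n)) {a b : Fin n → Level lam}
    (h : ∀ i, ZFSet.pair (a i).1 (b i).1 ∈ extend j (graph k)) :
    φ.Realize b ↔ φ.Realize a := by
  obtain ⟨δ, hδ⟩ := exists_pair_mem_map_truncGraph hj hlam h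
  refine (hj.iff (expressible_realize_iff_of_pairs φ) ![truncGraph k δ]).2 ?_ a b hδ
  intro a b hab
  have : b = k ∘ a := funext fun i => (pair_mem_truncGraph.1 (hab i)).1.symm
  rw [this]
  exact hk.iff (expressible_realize φ) a

theorem eq_of_pair_mem_extend (hlam : Order.IsSuccLimit lam) (hj : IsElementary j)
    (hk : IsElementary k) {x y z : Level lam} (hy : ZFSet.pair x.1 y.1 ∈ extend j (graph k))
    (hz : ZFSet.pair x.1 z.1 ∈ extend j (graph k)) : y = z := by
  obtain ⟨φ, hφ⟩ := expressible_eq (lam := lam) (.proj (0 : Fin 2)) (.proj 1)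
  -- Functionality is preservation of the formula `v₀ = v₁`, applied to `(x, x)` and `(y, z)`.
  have := realize_iff_of_pairs_mem_extend hlam hj hk φ (a := ![x, x]) (b := ![y, z])
    (by intro i; fin_cases i <;> assumption)
  rw [hφ, hφ] at this
  exact this.2 rfl

theorem exists_pair_mem_extend (hlam : Order.IsSuccLimit lam) (hj : IsElementary j)
    (hk : IsElementary k) (x : Level lam) :
    ∃ y : Level lam, ZFSet.pair x.1 y.1 ∈ extend j (graph k) := by
  -- An ordinal above the rank of `x`: since `j` does not lower rank, `x` lies in `j(V_b)`. The
  -- ranks of values of `k` on `V_b` are bounded by that of `k b`, so one truncation is total there.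
  let b : Level lam := ordElem ⟨Order.succ x.1.rank, hlam.succ_lt (rank_lt_lam x)⟩
  have hb : b.1.rank = Order.succ x.1.rank := rank_ordElem _
  obtain ⟨δ, hδ⟩ := exists_iio_rank_pair_lt hlam b (k b)
  have hE : Expressible fun v : Fin 2 → Level lam =>
      ∀ y : Level lam, y.1 ∈ (v 0).1 → ∃ z : Level lam, ZFSet.pair y.1 z.1 ∈ (v 1).1 :=
    .all <| .imp (expressible_mem (.proj _) (.proj _))
      (.ex (expressible_pair_mem (.proj _) (.proj _) (.proj _)))
  have hx : x.1 ∈ (j (stage b)).1 := by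
    rw [hj.map_stage hlam, stage, ZFSet.mem_vonNeumann]
    refine lt_of_lt_of_le ?_ (hj.rank_le_rank_map b)
    rw [hb]
    exact Order.lt_succ _
  have htotal : ∀ y : Level lam, y.1 ∈ (stage b).1 →
      ∃ z : Level lam, ZFSet.pair y.1 z.1 ∈ (truncGraph k δ).1 := fun y hy => by
    have hy' : y.1.rank < b.1.rank := ZFSet.mem_vonNeumann.1 hy
    exact ⟨k y, pair_mem_truncGraph.2 ⟨rfl, hδ _ _ hy'.le ((hk.rank_le_iff hlam _ _).2 hy'.le)⟩⟩
  obtain ⟨y, hy⟩ := (hj.iff hE ![stage b, truncGraph k δ]).2 htotal x hx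
  exact ⟨y, mem_extend_graph.2 ⟨δ, hy⟩⟩

theorem exists_eq_pair_of_mem_extend (hj : IsElementary j) {p : ZFSet.{u}}
    (hp : p ∈ extend j (graph k)) : ∃ x y : Level lam, p = ZFSet.pair x.1 y.1 := by
  obtain ⟨δ, hδ⟩ := mem_extend_graph.1 hp
  have hE : Expressible fun v : Fin 1 → Level lam =>
      ∀ p : Level lam, p.1 ∈ (v 0).1 → ∃ x y : Level lam, p.1 = ZFSet.pair x.1 y.1 :=
    .all <| .imp (expressible_mem (.proj _) (.proj _))
      (.ex <| .ex <| expressible_eq_pair (.proj _) (.proj _) (.proj _))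
  refine (hj.iff hE ![truncGraph k δ]).2 ?_ ⟨p, mem_level_of_mem hδ (Subtype.property _)⟩ hδ
  intro p hp
  obtain ⟨x, hx⟩ := ZFSet.mem_range.1 (ZFSet.mem_inter.1 hp).1
  exact ⟨x, k x, hx.symm⟩

theorem pair_app_mem_extend (hlam : Order.IsSuccLimit lam) (hj : IsElementary j)
    (hk : IsElementary k) (x : Level lam) :
    ZFSet.pair x.1 (app j k x).1 ∈ extend j (graph k) := by
  have h := exists_pair_mem_extend hlam hj hk x
  rw [app, dif_pos h]
  exact h.choose_spec

theorem app_eq_iff (hlam : Order.IsSuccLimit lam) (hj : IsElementary j)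
    (hk : IsElementary k) {x y : Level lam} :
    app j k x = y ↔ ZFSet.pair x.1 y.1 ∈ extend j (graph k) :=
  ⟨fun h => h ▸ pair_app_mem_extend hlam hj hk x,
    fun h => eq_of_pair_mem_extend hlam hj hk (pair_app_mem_extend hlam hj hk x) h⟩

theorem graph_app (hlam : Order.IsSuccLimit lam) (hj : IsElementary j) (hk : IsElementary k) :
    graph (app j k) = extend j (graph k) := by
  ext p
  constructor
  · intro hp
    obtain ⟨x, rfl⟩ := ZFSet.mem_range.1 hp
    exact pair_app_mem_extend hlam hj hk x
  · intro hp
    obtain ⟨x, y, rfl⟩ := exists_eq_pair_of_mem_extend hj hp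
    exact pair_mem_graph.2 ((app_eq_iff hlam hj hk).2 hp)

theorem IsElementary.app (hlam : Order.IsSuccLimit lam) (hj : IsElementary j)
    (hk : IsElementary k) : IsElementary (app j k) :=
  .of_formula fun _ φ x => realize_iff_of_pairs_mem_extend hlam hj hk φ
    fun i => pair_app_mem_extend hlam hj hk (x i)

theorem app_map (hlam : Order.IsSuccLimit lam) (hj : IsElementary j) (hk : IsElementary k)
    (x : Level lam) : app j k (j x) = j (k x) := by
  obtain ⟨δ, hδ⟩ := exists_iio_rank_pair_lt hlam x (k x)
  exact (app_eq_iff hlam hj hk).2 (mem_extend_graph.2 ⟨δ, (hj.pair_mem_iff _ _ _).2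
    (pair_mem_truncGraph.2 ⟨rfl, hδ _ _ le_rfl le_rfl⟩)⟩)

/-- If `k` fixes all sets of rank below that of `b`, then `j k` fixes all sets of rank below that
of `j b`. -/
theorem app_eq_self (hlam : Order.IsSuccLimit lam) (hj : IsElementary j) (hk : IsElementary k)
    {b : Level lam} (h : ∀ x : Level lam, x.1.rank < b.1.rank → k x = x) {x : Level lam}
    (hx : x.1.rank < (j b).1.rank) : app j k x = x := by
  obtain ⟨δ, hδ⟩ := exists_iio_rank_pair_lt hlam b b
  have hE : Expressible fun v : Fin 2 → Level lam =>
      ∀ y : Level lam, y.1 ∈ (v 0).1 → ZFSet.pair y.1 y.1 ∈ (v 1).1 :=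
    .all <| .imp (expressible_mem (.proj _) (.proj _))
      (expressible_pair_mem (.proj _) (.proj _) (.proj _))
  refine (app_eq_iff hlam hj hk).2 (mem_extend_graph.2 ⟨δ,
    (hj.iff hE ![stage b, truncGraph k δ]).2 (fun y hy => ?_) x ?_⟩)
  · have hy' : y.1.rank < b.1.rank := ZFSet.mem_vonNeumann.1 hy
    exact pair_mem_truncGraph.2 ⟨h y hy', hδ _ _ hy'.le hy'.le⟩
  · change x.1 ∈ (j (stage b)).1
    rwa [hj.map_stage hlam, stage, ZFSet.mem_vonNeumann]

end Application

/-! ### Critical sequences of right powers and the inverse limit. -/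

section CriticalSequence

variable {lam : Ordinal.{u}} {j : Level lam → Level lam}

theorem IsElementary.ordValue_strictMono (hlam : Order.IsSuccLimit lam) (hj : IsElementary j) :
    StrictMono (ordValue j) := fun α β h => by
  rw [ordValue, ordValue, hj.rank_lt_iff hlam, rank_ordElem, rank_ordElem]
  exact h

theorem ordValue_lt_lam (j : Level lam → Level lam) (α : Set.Iio lam) : ordValue j α < lam :=
  rank_lt_lam _

theorem IsElementary.le_ordValue (hj : IsElementary j) (α : Set.Iio lam) : α.1 ≤ ordValue j α := by
  have := hj.rank_le_rank_map (ordElem α)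
  rwa [rank_ordElem] at this

/-- An elementary map that moves no ordinal fixes every set, by induction on rank. -/
theorem movedOrdinals_nonempty (hlam : Order.IsSuccLimit lam) (hj : j ∈ rankEmbeddings lam) :
    (movedOrdinals j).Nonempty := by
  obtain ⟨he, hne⟩ := hj
  have he : IsElementary j := he
  by_contra hempty
  refine hne (funext fun x => he.map_eq_of_forall_ordValue hlam (γ := lam) (fun α _ => ?_) x
    (rank_lt_lam x))
  refine le_antisymm (not_lt.1 fun h => hempty ⟨α.1, α.2, h⟩) (he.le_ordValue α)

theorem isLeast_crit (hlam : Order.IsSuccLimit lam) (hj : j ∈ rankEmbeddings lam) :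
    IsLeast (movedOrdinals j) (crit j) :=
  ⟨csInf_mem (movedOrdinals_nonempty hlam hj), fun _ h => csInf_le' h⟩

theorem map_eq_of_rank_lt_crit (hlam : Order.IsSuccLimit lam) (hj : IsElementary j)
    {x : Level lam} (hx : x.1.rank < crit j) : j x = x :=
  hj.map_eq_of_forall_ordValue hlam (fun α hα => le_antisymm (not_lt.1 fun h =>
    notMem_of_lt_csInf' hα (show α.1 ∈ movedOrdinals j from ⟨α.2, h⟩)) (hj.le_ordValue α)) x hx

theorem critSeq_lt_lam (hlam : Order.IsSuccLimit lam) (hj : j ∈ rankEmbeddings lam) (n : ℕ) :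
    critSeq j n < lam := by
  induction n with
  | zero => exact (isLeast_crit hlam hj).1.1
  | succ n ih =>
    rw [critSeq, dif_pos ih]
    exact ordValue_lt_lam _ _

theorem critSeq_succ {n : ℕ} (h : critSeq j n < lam) :
    critSeq j (n + 1) = ordValue j ⟨critSeq j n, h⟩ := by
  rw [critSeq, dif_pos h]

theorem critSeq_strictMono (hlam : Order.IsSuccLimit lam) (hj : j ∈ rankEmbeddings lam) :
    StrictMono (critSeq j) := by
  refine strictMono_nat_of_lt_succ fun n => ?_
  induction n with
  | zero =>
    rw [critSeq_succ (critSeq_lt_lam hlam hj 0)]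
    exact (isLeast_crit hlam hj).1.2
  | succ n ih =>
    refine (critSeq_succ (critSeq_lt_lam hlam hj n)).trans_lt ?_
    rw [critSeq_succ (critSeq_lt_lam hlam hj (n + 1))]
    exact IsElementary.ordValue_strictMono hlam hj.1 ih

theorem ordValue_app_ordValue (hlam : Order.IsSuccLimit lam) (hj : IsElementary j)
    (α : Set.Iio lam) :
    ordValue (app j j) ⟨ordValue j α, ordValue_lt_lam j α⟩ =
      ordValue j ⟨ordValue j α, ordValue_lt_lam j α⟩ := by
  have h₁ := (hj.app hlam hj).rank_map hlam (j (ordElem α))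
  have h₂ := hj.rank_map hlam (j (ordElem α))
  rw [app_map hlam hj hj] at h₁
  exact h₁.symm.trans h₂

/-- Since `j` fixes everything of rank below `κ_0`, `jj` fixes everything of rank below `j(κ_0) =
κ_1`; and `(jj)(κ_1) = (jj)(j(κ_0)) = j(κ_1) = κ_2`. -/
theorem isLeast_movedOrdinals_app (hlam : Order.IsSuccLimit lam) (hj : j ∈ rankEmbeddings lam) :
    IsLeast (movedOrdinals (app j j)) (critSeq j 1) := by
  have he : IsElementary j := hj.1
  have h0 := critSeq_lt_lam hlam hj 0
  refine ⟨⟨critSeq_lt_lam hlam hj 1, ?_⟩, ?_⟩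
  · have h12 := critSeq_strictMono hlam hj (Nat.lt_succ_self 1)
    rw [critSeq_succ (critSeq_lt_lam hlam hj 1)] at h12
    simp only [critSeq_succ h0] at h12 ⊢
    rwa [ordValue_app_ordValue hlam he]
  · rintro α ⟨hα, hlt⟩
    by_contra! hα1
    refine hlt.ne' ?_
    have hfix : app j j (ordElem ⟨α, hα⟩) = ordElem ⟨α, hα⟩ := by
      refine app_eq_self hlam he he (b := ordElem ⟨critSeq j 0, h0⟩)
        (fun x hx => map_eq_of_rank_lt_crit hlam he ?_) ?_
      · rwa [rank_ordElem] at hx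
      · rw [rank_ordElem]
        rwa [critSeq_succ h0] at hα1
    rw [ordValue, hfix, rank_ordElem]

theorem app_mem_rankEmbeddings (hlam : Order.IsSuccLimit lam) (hj : j ∈ rankEmbeddings lam) :
    app j j ∈ rankEmbeddings lam := by
  refine ⟨IsElementary.app hlam hj.1 hj.1, fun h => ?_⟩
  obtain ⟨hl, hlt⟩ := (isLeast_movedOrdinals_app hlam hj).1
  rw [ordValue, h, id, rank_ordElem] at hlt
  exact lt_irrefl _ hlt

theorem critSeq_app (hlam : Order.IsSuccLimit lam) (hj : j ∈ rankEmbeddings lam) (n : ℕ) :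
    critSeq (app j j) n = critSeq j (n + 1) := by
  induction n with
  | zero =>
    exact (isLeast_crit hlam (app_mem_rankEmbeddings hlam hj)).unique
      (isLeast_movedOrdinals_app hlam hj)
  | succ n ih =>
    have hn := critSeq_lt_lam hlam hj n
    rw [critSeq_succ (critSeq_lt_lam hlam (app_mem_rankEmbeddings hlam hj) n),
      critSeq_succ (critSeq_lt_lam hlam hj (n + 1))]
    simp only [ih, critSeq_succ hn]
    exact ordValue_app_ordValue hlam hj.1 _

theorem rightPower_mem_rankEmbeddings (hlam : Order.IsSuccLimit lam)
    (hj : j ∈ rankEmbeddings lam) (n : ℕ) : rightPower j n ∈ rankEmbeddings lam := by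
  induction n with
  | zero => exact hj
  | succ n ih => exact app_mem_rankEmbeddings hlam ih

theorem critSeq_rightPower (hlam : Order.IsSuccLimit lam) (hj : j ∈ rankEmbeddings lam)
    (n m : ℕ) : critSeq (rightPower j n) m = critSeq j (n + m) := by
  induction n generalizing m with
  | zero => rw [rightPower, zero_add]
  | succ n ih =>
    rw [rightPower, critSeq_app hlam (rightPower_mem_rankEmbeddings hlam hj n), ih]
    congr 1
    omega

theorem crit_rightPower (hlam : Order.IsSuccLimit lam) (hj : j ∈ rankEmbeddings lam) (n : ℕ) :
    crit (rightPower j n) = critSeq j n :=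
  critSeq_rightPower hlam hj n 0

theorem rightPower_eq_self (hlam : Order.IsSuccLimit lam) (hj : j ∈ rankEmbeddings lam)
    {n : ℕ} {x : Level lam} (hx : x.1.rank < critSeq j n) : rightPower j n x = x := by
  rw [← crit_rightPower hlam hj] at hx
  exact map_eq_of_rank_lt_crit hlam (rightPower_mem_rankEmbeddings hlam hj n).1 hx

theorem ordValue_rightPower_critSeq (hlam : Order.IsSuccLimit lam) (hj : j ∈ rankEmbeddings lam)
    {n m : ℕ} (h : n ≤ m) :
    ordValue (rightPower j n) ⟨critSeq j m, critSeq_lt_lam hlam hj m⟩ = critSeq j (m + 1) := by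
  obtain ⟨d, rfl⟩ := Nat.exists_eq_add_of_le h
  have hd := critSeq_lt_lam hlam (rightPower_mem_rankEmbeddings hlam hj n) d
  have := critSeq_succ hd
  simp only [critSeq_rightPower hlam hj] at this
  rw [← this]
  rfl

theorem rank_rightPower_mem_Ico (hlam : Order.IsSuccLimit lam) (hj : j ∈ rankEmbeddings lam)
    {n m : ℕ} (h : n ≤ m) {x : Level lam}
    (hx : x.1.rank ∈ Set.Ico (critSeq j m) (critSeq j (m + 1))) :
    (rightPower j n x).1.rank ∈ Set.Ico (critSeq j (m + 1)) (critSeq j (m + 2)) := by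
  have he : IsElementary (rightPower j n) := (rightPower_mem_rankEmbeddings hlam hj n).1
  rw [← ordValue_rightPower_critSeq hlam hj h,
    ← ordValue_rightPower_critSeq hlam hj (h.trans m.le_succ), he.rank_map hlam]
  exact ⟨(he.ordValue_strictMono hlam).monotone hx.1, he.ordValue_strictMono hlam hx.2⟩

theorem rank_composite_mem_Ico (hlam : Order.IsSuccLimit lam) (hj : j ∈ rankEmbeddings lam)
    {n m : ℕ} (h : n ≤ m) {x : Level lam}
    (hx : x.1.rank ∈ Set.Ico (critSeq j m) (critSeq j (m + 1))) :
    (composite (rightPower j) n x).1.rank ∈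
      Set.Ico (critSeq j (m + n + 1)) (critSeq j (m + n + 2)) := by
  induction n generalizing m x with
  | zero => exact rank_rightPower_mem_Ico hlam hj h hx
  | succ n ih =>
    -- The innermost map `j^(n+1)` acts first and raises the interval index to `m + 1`; the other
    -- maps are left to the induction hypothesis.
    have := ih (m := m + 1) (by omega) (rank_rightPower_mem_Ico hlam hj h hx)
    rwa [show m + 1 + n = m + (n + 1) by omega] at this

theorem exists_rank_lt_critSeq (hlam : Order.IsSuccLimit lam) (hj : j ∈ rankEmbeddings lam)
    (a : LimitDomain (rightPower j)) : ∃ n, a.1.1.rank < critSeq j n := by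
  have h := ZFSet.mem_vonNeumann.1 a.2
  simp only [limitHeight, crit_rightPower hlam hj] at h
  exact (Filter.eventually_lt_of_lt_liminf h).exists

theorem rightPower_eq_self_of_le (hlam : Order.IsSuccLimit lam) (hj : j ∈ rankEmbeddings lam)
    {n m : ℕ} (h : n ≤ m) {x : Level lam} (hx : x.1.rank < critSeq j n) :
    rightPower j m x = x :=
  rightPower_eq_self hlam hj (hx.trans_le ((critSeq_strictMono hlam hj).monotone h))

theorem rank_inverseLimit_of_lt (hlam : Order.IsSuccLimit lam) (hj : j ∈ rankEmbeddings lam)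
    (a : LimitDomain (rightPower j)) (ha : a.1.1.rank < critSeq j 0) :
    (inverseLimit (rightPower j) a).1.rank < critSeq j 0 := by
  have hN : sInf {n : ℕ | ∀ m > n, rightPower j m a.1 = a.1} = 0 :=
    Nat.sInf_eq_zero.2 (Or.inl fun m _ => rightPower_eq_self_of_le hlam hj m.zero_le ha)
  rw [inverseLimit, hN, composite, rightPower_eq_self hlam hj ha]
  exact ha

theorem rank_inverseLimit_mem_Ico (hlam : Order.IsSuccLimit lam) (hj : j ∈ rankEmbeddings lam)
    (a : LimitDomain (rightPower j)) {n : ℕ}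
    (ha : a.1.1.rank ∈ Set.Ico (critSeq j n) (critSeq j (n + 1))) :
    (inverseLimit (rightPower j) a).1.rank ∈
      Set.Ico (critSeq j (2 * n + 1)) (critSeq j (2 * n + 2)) := by
  have hn : n ∈ {n : ℕ | ∀ m > n, rightPower j m a.1 = a.1} := fun m hm =>
    rightPower_eq_self_of_le hlam hj hm ha.2
  -- No smaller index qualifies, since `j^(n)` itself moves `a`: it raises the rank to at least
  -- `κ_(n+1)`. So exactly `n + 1` maps are composed.
  have hN : sInf {n : ℕ | ∀ m > n, rightPower j m a.1 = a.1} = n := by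
    refine le_antisymm (Nat.sInf_le hn) (not_lt.1 fun hlt => ?_)
    have hmoved := (rank_rightPower_mem_Ico hlam hj le_rfl ha).1
    rw [Nat.sInf_mem ⟨n, hn⟩ n hlt] at hmoved
    exact hmoved.not_gt ha.2
  rw [inverseLimit, hN, two_mul]
  exact rank_composite_mem_Ico hlam hj le_rfl ha

end CriticalSequence

end RankToRank

open RankToRank in
theorem proposition17 (lam : Ordinal.{u}) (hlam : Order.IsSuccLimit lam)
    (j : Level lam → Level lam) (hj : j ∈ rankEmbeddings lam) :
    -- the critical points, the critical sequence, the right powers and `k` are well defined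
    ((∀ n, IsLeast (movedOrdinals (rightPower j n)) (crit (rightPower j n))) ∧
      (∀ n, critSeq j n < lam) ∧
      (∀ n, graph (rightPower j (n + 1)) = extend (rightPower j n) (graph (rightPower j n))) ∧
      (∀ a : LimitDomain (rightPower j), ∃ n, ∀ m > n, rightPower j m a.1 = a.1)) ∧
    -- the ordinals below `lam` in the range of `k = j ∘ j^(1) ∘ j^(2) ∘ ⋯`
    {α : Ordinal.{u} | α < lam ∧ ∃ a, (inverseLimit (rightPower j) a).1 = α.toZFSet} ⊆
      Set.Iio (critSeq j 0) ∪
        ⋃ n : ℕ, Set.Ico (critSeq j (2 * n + 1)) (critSeq j (2 * n + 2)) := by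
  refine ⟨⟨fun n => isLeast_crit hlam (rightPower_mem_rankEmbeddings hlam hj n),
    critSeq_lt_lam hlam hj, fun n => ?_, fun a => ?_⟩, ?_⟩
  · have he := (rightPower_mem_rankEmbeddings hlam hj n).1
    exact graph_app hlam he he
  · obtain ⟨n, hn⟩ := exists_rank_lt_critSeq hlam hj a
    exact ⟨n, fun m hm => rightPower_eq_self_of_le hlam hj (le_of_lt hm) hn⟩
  · rintro α ⟨-, a, ha⟩
    have hα : (inverseLimit (rightPower j) a).1.rank = α := by
      rw [ha, Ordinal.rank_toZFSet]
    have hex := exists_rank_lt_critSeq hlam hj a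
    rw [← hα]
    -- The least index whose critical point exceeds the rank of `a` locates that rank: `0` means
    -- below `κ_0`, and `n + 1` means in `[κ_n, κ_(n+1))`.
    rcases hN : Nat.find hex with _ | n
    · refine Or.inl (rank_inverseLimit_of_lt hlam hj a ?_)
      have := Nat.find_spec hex
      rwa [hN] at this
    · refine Or.inr (Set.mem_iUnion.2 ⟨n, rank_inverseLimit_mem_Ico hlam hj a ⟨?_, ?_⟩⟩)
      · exact not_lt.1 (Nat.find_min hex (by omega))
      · have := Nat.find_spec hex
        rwa [hN] at this
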